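/- Let $(\mu(t,\cdot))_{t\ge 0}$ be a weakly continuous family of probability measures on $\mathbb R$ whose Green's function $G(t,z)=\int_{\mathbb R}\frac{\mu(t,dx)}{z-x}$ satisfies the complex Burgers equation $\partial_t G+G\,\partial_z G=0$ for $t\ge 0$, $z\in\mathbb C\setminus\mathbb R$, and suppose that for every $t>0$ the measure $\mu(t,\cdot)$ has a continuous probability density $\rho(t,\cdot)$; the initial measure $\mu(0,\cdot)$ is arbitrary. Let $M_s(x_0)=\lim_{\varepsilon\downarrow 0}\{x_0+sG(0,x_0+i\varepsilon)\}$ be the real characteristic map. For $t>0$ let $\mathcal D_t$ be the set of those $x_0\in\mathbb R$ whose real characteristic does not break down before time $t$, that is: the limit $\lim_{\varepsilon\downarrow 0}G(0,x_0+i\varepsilon)$ exists and is real, and for all $0\le s<t$ the derivative $M_s'(x_0)=\lim_{\varepsilon\downarrow0}\left(1+s\,\partial_zG(0,x_0+i\varepsilon)\right)$ exists, is real and is positive. Let $\mathcal I_t=M_t(\mathcal D_t)$. Then, for every $t>0$: (a) $M_s$ is injective on $\mathcal D_t$ for every $0\le s\le t$; (b) a point $x_0$ outside the closed support of the measure $\mu(0,\cdot)$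 belongs to $\mathcal D_t$ if and only if the real characteristics issued near $x_0$ do not cross before time $t$, that is, for each $0\le t'<t$ there is a neighbourhood $U$ of $x_0$ such that $M_s$ is injective on $U$ for all $0\le s\le t'$; (c) $\operatorname{supp}\rho(t,\cdot)=\mathbb R\setminus\mathcal I_t$, where $\operatorname{supp}\rho(t,\cdot)=\{x\in\mathbb R:\rho(t,x)\ne 0\}$ (no closure is taken). In other words, the support of the density is the region where the real characteristics break down. -/

import Mathlib

open Set Filter Topology MeasureTheory

/-- The Green's function (Stieltjes transform) `G(z) = ∫ dμ(x) / (z - x)` of a measure on `ℝ`. -/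
noncomputable def green (μ : Measure ℝ) (z : ℂ) : ℂ :=
  ∫ x : ℝ, 1 / (z - (x : ℂ)) ∂μ

/-- A hydrodynamic flow: a weakly continuous family `(μ t)`, `t ≥ 0`, of probability measures on `ℝ`
whose Green's function `G(t, z)` solves the inviscid complex Burgers equation
`∂G/∂t + G ∂G/∂z = 0` for `t ≥ 0` and `z ∈ ℂ \ ℝ` (at `t = 0` the time derivative is one-sided).
The values `μ t` for `t < 0` play no role. -/
structure IsHydrodynamicFlow (μ : ℝ → ProbabilityMeasure ℝ) : Prop where
  continuousOn : ContinuousOn μ (Ici 0)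
  burgers : ∀ t : ℝ, 0 ≤ t → ∀ z : ℂ, z.im ≠ 0 →
    HasDerivWithinAt (fun s : ℝ => green (μ s : Measure ℝ) z)
      (-(green (μ t : Measure ℝ) z * deriv (green (μ t : Measure ℝ)) z)) (Ici 0) t

/-- `f` is a continuous probability density of `ν` with respect to Lebesgue measure. -/
structure IsContinuousDensity (ν : ProbabilityMeasure ℝ) (f : ℝ → ℝ) : Prop where
  nonneg : ∀ x, 0 ≤ f x
  continuous : Continuous f
  eq_withDensity : (ν : Measure ℝ) = volume.withDensity (fun x => ENNReal.ofReal (f x))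

/-- The complex characteristic map `z₀ ↦ z₀ + t G(0, z₀)`. -/
noncomputable def charMap (μ₀ : Measure ℝ) (t : ℝ) (z : ℂ) : ℂ :=
  z + (t : ℂ) * green μ₀ z

/-- The real characteristic map `M_t(x₀) = lim_{ε ↓ 0} (t G(0, x₀ + i ε) + x₀)`; it is meaningful
at the points `x₀` where the limit exists and is real. -/
noncomputable def realChar (μ₀ : Measure ℝ) (t : ℝ) (x₀ : ℝ) : ℝ :=
  (limUnder (𝓝[>] (0 : ℝ))
    (fun ε : ℝ => (t : ℂ) * green μ₀ ((x₀ : ℂ) + (ε : ℂ) * Complex.I) + (x₀ : ℂ))).re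

/-- The set `D_t` of the starting points `x₀ ∈ ℝ` of real characteristics that do not break down
before time `t`: the boundary value `G(0, x₀ + i0)` exists and is real, and for every `0 ≤ s < t`
the derivative of the characteristic map `M_s` exists at `x₀` (as a boundary value from the upper
half-plane) and is real and positive. -/
def charDomain (μ₀ : Measure ℝ) (t : ℝ) : Set ℝ :=
  {x₀ : ℝ |
    (∃ g : ℝ, Tendsto (fun ε : ℝ => green μ₀ ((x₀ : ℂ) + (ε : ℂ) * Complex.I))
      (𝓝[>] 0) (𝓝 (g : ℂ))) ∧
    ∀ s ∈ Ico (0 : ℝ) t, ∃ m : ℝ, 0 < m ∧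
      Tendsto (fun ε : ℝ => deriv (charMap μ₀ s) ((x₀ : ℂ) + (ε : ℂ) * Complex.I))
        (𝓝[>] 0) (𝓝 (m : ℂ))}

/-- The image `I_t = M_t(D_t)`. -/
noncomputable def charImage (μ₀ : Measure ℝ) (t : ℝ) : Set ℝ :=
  realChar μ₀ t '' charDomain μ₀ t

/-- Real characteristics issued from points close to `x₀` do not cross before time `t`: for each
`t' < t` there is a neighbourhood of `x₀` on which `M_s` is injective for all `0 ≤ s ≤ t'`. -/
def NoCrossingNear (μ₀ : Measure ℝ) (t : ℝ) (x₀ : ℝ) : Prop :=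
  ∀ t' ∈ Ico (0 : ℝ) t, ∃ U ∈ 𝓝 x₀, ∀ s ∈ Icc (0 : ℝ) t', InjOn (realChar μ₀ s) U

/-!
The whole statement is governed by the inverse square energy `E(z) = ∫ |z - x|⁻² dμ(0, x)`. Since
`Im G(0, z) = -E(z) Im z` and, at real points of finite energy, `∂G/∂z = -E`, a real characteristic
issued from `u` does not break down before time `t` exactly when `E(u) ≤ 1 / t`
(`mem_charDomain_iff`). The delicate direction reads `E(u)` off from the vertical derivative of
`Im G` at `u`, by Fatou's lemma.

The resolvent identity gives `M_s(u) - M_s(v) = (u - v) (1 - s P(u, v))` (`realChar_sub`), where the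
pairing `P(u, v) = ∫ (u - x)⁻¹ (v - x)⁻¹ dμ(0, x)` is strictly below the mean of `E(u)` and `E(v)`
when `u ≠ v`. This yields injectivity on the domain. Off the support of `μ(0, ·)` the pairing is
continuous, and two characteristics issued from `u` and `v` meet at the time `1 / P(u, v)`, which
tends to `1 / E(x₀)` as `u, v → x₀`; this yields the description of the domain by crossings.

For the density, the Burgers equation makes `G` constant along complex characteristics that stay in
the upper half-plane, forwards and backwards in time (`IsHydrodynamicFlow.green_line_iff`). If
`E(u) ≤ 1 / t`, the points `u + iε` are carried into the upper half-plane and towards `M_t(u)`, with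
`Im G → 0`, so the density vanishes at `M_t(u)`. Conversely, if the density vanishes at `y`, then the
complex characteristics arriving at `y + iε` at time `t` start at points `z` with `Im z → 0` and
`E(z) ≤ 1 / t`; these remain bounded, and any cluster point `u` is real, satisfies `E(u) ≤ 1 / t` by
Fatou's lemma, and `M_t(u) = y` by the Lipschitz bound for `G(0, ·)` that the energy provides.
-/

/-! ### Inverse square energy and resolvent pairing -/

/-- The inverse square energy `∫ |z - x|⁻² dμ(x)`. It takes values in `[0, ∞]`, so that it is
meaningful at every real `z` as well: an atom of `μ` at `z` makes it infinite. -/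
noncomputable def inverseSquareEnergy (μ : Measure ℝ) (z : ℂ) : ENNReal :=
  ∫⁻ x : ℝ, (‖z - x‖ₑ ^ 2)⁻¹ ∂μ

/-- The bilinear pairing `∫ (z - x)⁻¹ (w - x)⁻¹ dμ(x)` of two resolvents, which is the negative of
the divided difference of the Green's function at `z` and `w`. -/
noncomputable def resolventPairing (μ : Measure ℝ) (z w : ℂ) : ℂ :=
  ∫ x : ℝ, (z - x)⁻¹ * (w - x)⁻¹ ∂μ

lemma green_eq (μ : Measure ℝ) (z : ℂ) : green μ z = ∫ x : ℝ, (z - x)⁻¹ ∂μ := by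
  simp [green]

lemma inv_enorm_sq_eq {w : ℂ} (hw : w ≠ 0) : (‖w‖ₑ ^ 2)⁻¹ = ENNReal.ofReal (‖w⁻¹‖ ^ 2) := by
  rw [← ofReal_norm, ← ENNReal.ofReal_pow (norm_nonneg _),
    ← ENNReal.ofReal_inv_of_pos (by positivity), norm_inv, inv_pow]

section Energy

variable {μ : Measure ℝ} {z w : ℂ}

lemma ae_sub_ne_zero (hz : inverseSquareEnergy μ z ≠ ⊤) : ∀ᵐ x : ℝ ∂μ, z - x ≠ 0 := by
  filter_upwards [ae_lt_top (by fun_prop) hz] with x hx h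
  simp [h] at hx

lemma inverseSquareEnergy_eq (hz : ∀ᵐ x : ℝ ∂μ, z - x ≠ 0) :
    inverseSquareEnergy μ z = ∫⁻ x : ℝ, ENNReal.ofReal (‖(z - x)⁻¹‖ ^ 2) ∂μ :=
  lintegral_congr_ae (hz.mono fun _ hx => inv_enorm_sq_eq hx)

lemma integrable_norm_inv_sq (hz : inverseSquareEnergy μ z ≠ ⊤) :
    Integrable (fun x : ℝ => ‖(z - x)⁻¹‖ ^ 2) μ := by
  refine ⟨by fun_prop, ?_⟩
  rw [hasFiniteIntegral_iff_ofReal (ae_of_all _ fun x => by positivity),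
    ← inverseSquareEnergy_eq (ae_sub_ne_zero hz)]
  exact hz.lt_top

lemma integral_norm_inv_sq (hz : inverseSquareEnergy μ z ≠ ⊤) :
    ∫ x : ℝ, ‖(z - x)⁻¹‖ ^ 2 ∂μ = (inverseSquareEnergy μ z).toReal := by
  rw [integral_eq_lintegral_of_nonneg_ae (ae_of_all _ fun x => by positivity) (by fun_prop),
    ← inverseSquareEnergy_eq (ae_sub_ne_zero hz)]

lemma memLp_inv_sub (hz : inverseSquareEnergy μ z ≠ ⊤) :
    MemLp (fun x : ℝ => (z - x)⁻¹) 2 μ :=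
  (memLp_two_iff_integrable_sq_norm (by fun_prop)).2 (integrable_norm_inv_sq hz)

lemma integrable_inv_sub [IsFiniteMeasure μ] (hz : inverseSquareEnergy μ z ≠ ⊤) :
    Integrable (fun x : ℝ => (z - x)⁻¹) μ :=
  (memLp_inv_sub hz).integrable (by norm_num)

lemma integrable_inv_mul_inv (hz : inverseSquareEnergy μ z ≠ ⊤) (hw : inverseSquareEnergy μ w ≠ ⊤) :
    Integrable (fun x : ℝ => (z - x)⁻¹ * (w - x)⁻¹) μ :=
  (memLp_inv_sub hz).integrable_mul (memLp_inv_sub hw)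

lemma inverseSquareEnergy_le_of_le_norm [IsProbabilityMeasure μ] {d : ℝ} (hd : 0 < d)
    (h : ∀ᵐ x : ℝ ∂μ, d ≤ ‖z - x‖) : inverseSquareEnergy μ z ≤ ENNReal.ofReal ((d ^ 2)⁻¹) := by
  calc inverseSquareEnergy μ z ≤ ∫⁻ _ : ℝ, ENNReal.ofReal ((d ^ 2)⁻¹) ∂μ := by
        refine lintegral_mono_ae (h.mono fun x hx => ?_)
        rw [inv_enorm_sq_eq (norm_pos_iff.1 (hd.trans_le hx)), norm_inv, inv_pow]
        gcongr
    _ = _ := by simp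

lemma abs_im_le_norm_sub (z : ℂ) (x : ℝ) : |z.im| ≤ ‖z - x‖ := by
  simpa using Complex.abs_im_le_norm (z - x)

lemma sub_ofReal_ne_zero (hz : z.im ≠ 0) (x : ℝ) : z - x ≠ 0 := fun h => hz <| by
  simpa using congrArg Complex.im h

lemma inverseSquareEnergy_ne_top_of_im_ne_zero [IsProbabilityMeasure μ] (hz : z.im ≠ 0) :
    inverseSquareEnergy μ z ≠ ⊤ :=
  ne_top_of_le_ne_top ENNReal.ofReal_ne_top <|
    inverseSquareEnergy_le_of_le_norm (abs_pos.2 hz) (ae_of_all _ fun x => abs_im_le_norm_sub z x)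

lemma norm_resolventPairing_le (hz : inverseSquareEnergy μ z ≠ ⊤)
    (hw : inverseSquareEnergy μ w ≠ ⊤) :
    ‖resolventPairing μ z w‖ ≤
      ((inverseSquareEnergy μ z).toReal + (inverseSquareEnergy μ w).toReal) / 2 := by
  rw [← integral_norm_inv_sq hz, ← integral_norm_inv_sq hw,
    ← integral_add (integrable_norm_inv_sq hz) (integrable_norm_inv_sq hw), ← integral_div]
  refine norm_integral_le_of_norm_le
    (((integrable_norm_inv_sq hz).add (integrable_norm_inv_sq hw)).div_const 2)
    (ae_of_all _ fun x => ?_)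
  rw [norm_mul]
  have := two_mul_le_add_sq ‖(z - x)⁻¹‖ ‖(w - x)⁻¹‖
  linarith

lemma norm_green_le [IsProbabilityMeasure μ] (hz : inverseSquareEnergy μ z ≠ ⊤) :
    ‖green μ z‖ ≤ (1 + (inverseSquareEnergy μ z).toReal) / 2 := by
  have h1 : ∫ x : ℝ, (1 + ‖(z - x)⁻¹‖ ^ 2) / 2 ∂μ = (1 + (inverseSquareEnergy μ z).toReal) / 2 := by
    rw [integral_div, integral_add (integrable_const _) (integrable_norm_inv_sq hz),
      integral_norm_inv_sq hz]
    simp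
  rw [green_eq, ← h1]
  refine norm_integral_le_of_norm_le
    (((integrable_const _).add (integrable_norm_inv_sq hz)).div_const 2) (ae_of_all _ fun x => ?_)
  have := two_mul_le_add_sq 1 ‖(z - x)⁻¹‖
  linarith

/-- The resolvent identity, integrated. -/
lemma green_sub_green [IsProbabilityMeasure μ] (hz : inverseSquareEnergy μ z ≠ ⊤)
    (hw : inverseSquareEnergy μ w ≠ ⊤) :
    green μ z - green μ w = -((z - w) * resolventPairing μ z w) := by
  rw [green_eq, green_eq, ← integral_sub (integrable_inv_sub hz) (integrable_inv_sub hw),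
    resolventPairing, ← integral_const_mul, ← integral_neg]
  refine integral_congr_ae ?_
  filter_upwards [ae_sub_ne_zero hz, ae_sub_ne_zero hw] with x hx hx'
  field_simp
  ring

lemma green_im [IsProbabilityMeasure μ] (hz : inverseSquareEnergy μ z ≠ ⊤) :
    (green μ z).im = -(z.im * (inverseSquareEnergy μ z).toReal) := by
  rw [green_eq, ← integral_norm_inv_sq hz, ← integral_const_mul, ← integral_neg]
  refine (Complex.imCLM.integral_comp_comm (integrable_inv_sub hz)).symm.trans
    (integral_congr_ae (ae_of_all _ fun x => ?_))
  simp [Complex.inv_im, Complex.normSq_eq_norm_sq, div_eq_mul_inv]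

lemma green_ofReal_im (μ : Measure ℝ) (u : ℝ) : (green μ u).im = 0 := by
  have : green μ u = ((∫ x : ℝ, (u - x)⁻¹ ∂μ : ℝ) : ℂ) := by
    rw [green_eq, ← integral_complex_ofReal]
    simp
  rw [this, Complex.ofReal_im]

lemma ofReal_green_re (μ : Measure ℝ) (u : ℝ) : (((green μ u).re : ℝ) : ℂ) = green μ u :=
  Complex.ext (by simp) (by simp [green_ofReal_im])

lemma resolventPairing_self_ofReal {u : ℝ} (hu : inverseSquareEnergy μ u ≠ ⊤) :
    resolventPairing μ u u = ((inverseSquareEnergy μ u).toReal : ℂ) := by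
  rw [← integral_norm_inv_sq hu, ← integral_complex_ofReal, resolventPairing]
  refine integral_congr_ae (ae_of_all _ fun x => ?_)
  have : ‖((u : ℂ) - x)⁻¹‖ ^ 2 = (u - x)⁻¹ ^ 2 := by
    rw [← Complex.ofReal_sub, ← Complex.ofReal_inv, Complex.norm_real, Real.norm_eq_abs, sq_abs]
  simp only [this]
  push_cast
  ring

/-- The arithmetic mean inequality bounding the pairing is strict, since the resolvents at two
different real points are nowhere equal. -/
lemma resolventPairing_re_lt [IsProbabilityMeasure μ] {u v : ℝ} (huv : u ≠ v)
    (hu : inverseSquareEnergy μ u ≠ ⊤) (hv : inverseSquareEnergy μ v ≠ ⊤) :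
    (resolventPairing μ u v).re <
      ((inverseSquareEnergy μ u).toReal + (inverseSquareEnergy μ v).toReal) / 2 := by
  have hint := integrable_inv_mul_inv hu hv
  have hi : Integrable (fun x : ℝ => (((u : ℂ) - x)⁻¹ * ((v : ℂ) - x)⁻¹).re) μ := hint.re
  have hs : Integrable (fun x : ℝ => (‖((u : ℂ) - x)⁻¹‖ ^ 2 + ‖((v : ℂ) - x)⁻¹‖ ^ 2) / 2) μ :=
    ((integrable_norm_inv_sq hu).add (integrable_norm_inv_sq hv)).div_const 2
  have hre : (resolventPairing μ u v).re = ∫ x : ℝ, (((u : ℂ) - x)⁻¹ * ((v : ℂ) - x)⁻¹).re ∂μ :=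
    (Complex.reCLM.integral_comp_comm hint).symm
  rw [← integral_norm_inv_sq hu, ← integral_norm_inv_sq hv,
    ← integral_add (integrable_norm_inv_sq hu) (integrable_norm_inv_sq hv), ← integral_div, hre,
    ← sub_pos, ← integral_sub hs hi]
  have key : ∀ x : ℝ, (‖((u : ℂ) - x)⁻¹‖ ^ 2 + ‖((v : ℂ) - x)⁻¹‖ ^ 2) / 2 -
      (((u : ℂ) - x)⁻¹ * ((v : ℂ) - x)⁻¹).re = ((u - x)⁻¹ - (v - x)⁻¹) ^ 2 / 2 := by
    intro x
    rw [← Complex.ofReal_sub, ← Complex.ofReal_sub, ← Complex.ofReal_inv, ← Complex.ofReal_inv,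
      ← Complex.ofReal_mul, Complex.norm_real, Complex.norm_real, Complex.ofReal_re,
      Real.norm_eq_abs, Real.norm_eq_abs, sq_abs, sq_abs]
    ring
  have hnn : 0 ≤ᵐ[μ] fun x : ℝ => (‖((u : ℂ) - x)⁻¹‖ ^ 2 + ‖((v : ℂ) - x)⁻¹‖ ^ 2) / 2 -
      (((u : ℂ) - x)⁻¹ * ((v : ℂ) - x)⁻¹).re :=
    ae_of_all _ fun x => by simp only [key, Pi.zero_apply]; positivity
  refine (integral_pos_iff_support_of_nonneg_ae hnn (hs.sub hi)).2 ?_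
  have hsupp : (Function.support fun x : ℝ => (‖((u : ℂ) - x)⁻¹‖ ^ 2 + ‖((v : ℂ) - x)⁻¹‖ ^ 2) / 2 -
      (((u : ℂ) - x)⁻¹ * ((v : ℂ) - x)⁻¹).re) = univ := by
    refine eq_univ_of_forall fun x => ?_
    simp only [Function.mem_support, key]
    have := sub_ne_zero.2 fun h : (u - x)⁻¹ = (v - x)⁻¹ => huv (by linarith [inv_injective h])
    positivity
  rw [hsupp, measure_univ]
  exact one_pos

/-- Fatou's lemma: the inverse square energy is lower semicontinuous. -/
lemma inverseSquareEnergy_le_liminf {ι : Type*} {l : Filter ι} [l.NeBot] [l.IsCountablyGenerated]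
    {f : ι → ℂ} (hf : Tendsto f l (𝓝 z)) :
    inverseSquareEnergy μ z ≤ liminf (fun i => inverseSquareEnergy μ (f i)) l := by
  refine le_trans (le_of_eq ?_) (lintegral_liminf_le fun i => by fun_prop)
  refine lintegral_congr fun x => ?_
  have h1 : Tendsto (fun i => (‖f i - x‖ₑ ^ 2)⁻¹) l (𝓝 (‖z - x‖ₑ ^ 2)⁻¹) :=
    (((ENNReal.continuous_pow 2).tendsto _).comp (hf.sub_const (x : ℂ)).enorm).inv
  exact h1.liminf_eq.symm

/-- Continuity of the resolvent pairing at points at a positive distance from `μ`. -/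
lemma tendsto_resolventPairing [IsProbabilityMeasure μ] {ι : Type*} {l : Filter ι}
    [l.IsCountablyGenerated] {f g : ι → ℂ} (hf : Tendsto f l (𝓝 z)) (hg : Tendsto g l (𝓝 w))
    {d : ℝ} (hd : 0 < d) (hzd : ∀ᵐ x : ℝ ∂μ, d ≤ ‖z - x‖) (hwd : ∀ᵐ x : ℝ ∂μ, d ≤ ‖w - x‖) :
    Tendsto (fun i => resolventPairing μ (f i) (g i)) l (𝓝 (resolventPairing μ z w)) := by
  have aux : ∀ {a b : ℂ} {x : ℝ}, d ≤ ‖a - x‖ → ‖b - a‖ < d / 2 → ‖(b - x)⁻¹‖ ≤ 2 / d := by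
    intro a b x h1 h2
    have h3 : d / 2 ≤ ‖b - x‖ := by
      have h4 := norm_sub_norm_le (a - x) (a - b)
      rw [sub_sub_sub_cancel_left, norm_sub_rev a b] at h4
      linarith
    rw [norm_inv, inv_le_comm₀ (by linarith) (by positivity), inv_div]
    exact h3
  refine tendsto_integral_filter_of_dominated_convergence (fun _ => 2 / d * (2 / d))
    (Eventually.of_forall fun i => by fun_prop) ?_ (integrable_const _) ?_
  · filter_upwards [tendsto_iff_norm_sub_tendsto_zero.1 hf |>.eventually_lt_const (half_pos hd),
      tendsto_iff_norm_sub_tendsto_zero.1 hg |>.eventually_lt_const (half_pos hd)] with i hi hi'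
    filter_upwards [hzd, hwd] with x hx hx'
    rw [norm_mul]
    gcongr
    exacts [aux hx hi, aux hx' hi']
  · filter_upwards [hzd, hwd] with x hx hx'
    exact ((hf.sub_const _).inv₀ (norm_pos_iff.1 (hd.trans_le hx))).mul
      ((hg.sub_const _).inv₀ (norm_pos_iff.1 (hd.trans_le hx')))

lemma hasDerivAt_green [IsProbabilityMeasure μ] (hz : z.im ≠ 0) :
    HasDerivAt (green μ) (-resolventPairing μ z z) z := by
  rw [hasDerivAt_iff_tendsto_slope]
  have h : Tendsto (fun w => -resolventPairing μ w z) (𝓝[≠] z) (𝓝 (-resolventPairing μ z z)) :=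
    (tendsto_resolventPairing (tendsto_id.mono_left nhdsWithin_le_nhds) tendsto_const_nhds
      (abs_pos.2 hz) (ae_of_all _ fun x => abs_im_le_norm_sub z x)
      (ae_of_all _ fun x => abs_im_le_norm_sub z x)).neg
  refine h.congr' ?_
  have hne : ∀ᶠ w : ℂ in 𝓝[≠] z, w.im ≠ 0 :=
    nhdsWithin_le_nhds (Complex.continuous_im.continuousAt.eventually_ne hz)
  filter_upwards [hne, self_mem_nhdsWithin] with w hw hwz
  rw [slope_def_field, green_sub_green (inverseSquareEnergy_ne_top_of_im_ne_zero hw)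
    (inverseSquareEnergy_ne_top_of_im_ne_zero hz)]
  have := sub_ne_zero.2 (show w ≠ z from hwz)
  field_simp

end Energy

/-! ### Boundary values and the domain of the real characteristics -/

section Boundary

variable {μ : Measure ℝ} {u v t : ℝ}

lemma norm_sub_le_norm_add_mul_I_sub (u ε x : ℝ) :
    ‖(u : ℂ) - x‖ ≤ ‖(u : ℂ) + ε * Complex.I - x‖ := by
  rw [← Complex.ofReal_sub, Complex.norm_real, Real.norm_eq_abs]
  simpa using Complex.abs_re_le_norm ((u : ℂ) + ε * Complex.I - x)

lemma inverseSquareEnergy_add_mul_I_le (μ : Measure ℝ) (u ε : ℝ) :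
    inverseSquareEnergy μ (u + ε * Complex.I) ≤ inverseSquareEnergy μ u := by
  refine lintegral_mono fun x => ?_
  gcongr 1
  rw [← ofReal_norm, ← ofReal_norm]
  gcongr
  exact norm_sub_le_norm_add_mul_I_sub u ε x

lemma tendsto_add_mul_I (u : ℝ) :
    Tendsto (fun ε : ℝ => (u : ℂ) + (ε : ℂ) * Complex.I) (𝓝[>] 0) (𝓝 u) := by
  have : ContinuousAt (fun ε : ℝ => (u : ℂ) + (ε : ℂ) * Complex.I) 0 := by fun_prop
  simpa using (this.tendsto).mono_left nhdsWithin_le_nhds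

lemma tendsto_resolventPairing_boundary (hu : inverseSquareEnergy μ u ≠ ⊤) :
    Tendsto (fun ε : ℝ => resolventPairing μ ((u : ℂ) + (ε : ℂ) * Complex.I)
      ((u : ℂ) + (ε : ℂ) * Complex.I)) (𝓝[>] 0) (𝓝 ((inverseSquareEnergy μ u).toReal : ℂ)) := by
  rw [← resolventPairing_self_ofReal hu]
  refine tendsto_integral_filter_of_dominated_convergence _
    (Eventually.of_forall fun ε => by fun_prop) (Eventually.of_forall fun ε => ?_)
    (integrable_norm_inv_sq hu) ?_
  · filter_upwards [ae_sub_ne_zero hu] with x hx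
    have := norm_pos_iff.2 hx
    rw [norm_mul, ← sq, norm_inv, norm_inv]
    gcongr
    exact norm_sub_le_norm_add_mul_I_sub u ε x
  · filter_upwards [ae_sub_ne_zero hu] with x hx
    have h := ((tendsto_add_mul_I u).sub_const (x : ℂ)).inv₀ hx
    exact h.mul h

lemma ne_top_of_le_ofReal {c : ℝ} (hu : inverseSquareEnergy μ u ≤ ENNReal.ofReal c) :
    inverseSquareEnergy μ u ≠ ⊤ := ne_top_of_le_ne_top ENNReal.ofReal_ne_top hu

lemma toReal_le_inv (ht : 0 < t) {z : ℂ} (hz : inverseSquareEnergy μ z ≤ ENNReal.ofReal t⁻¹) :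
    (inverseSquareEnergy μ z).toReal ≤ t⁻¹ :=
  ENNReal.toReal_le_of_le_ofReal (by positivity) hz

/-- Off the support of `μ`, a small interval around `x₀` stays away from almost every point. -/
lemma exists_dist_of_notMem_support {x₀ : ℝ} (hx₀ : x₀ ∉ μ.support) :
    ∃ d > 0, ∀ u : ℝ, |u - x₀| < d → ∀ᵐ x : ℝ ∂μ, d ≤ ‖(u : ℂ) - x‖ := by
  obtain ⟨U, hU, hU0⟩ := Measure.notMem_support_iff_exists.1 hx₀
  obtain ⟨r, hr, hrU⟩ := Metric.mem_nhds_iff.1 hU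
  refine ⟨r / 2, by positivity, fun u hu => ?_⟩
  filter_upwards [measure_eq_zero_iff_ae_notMem.1 (measure_mono_null hrU hU0)] with x hx
  rw [Metric.mem_ball, not_lt, Real.dist_eq] at hx
  rw [← Complex.ofReal_sub, Complex.norm_real, Real.norm_eq_abs]
  have := abs_sub_le x u x₀
  rw [abs_sub_comm x u] at this
  linarith

variable [IsProbabilityMeasure μ]

lemma tendsto_green_boundary (hu : inverseSquareEnergy μ u ≠ ⊤) :
    Tendsto (fun ε : ℝ => green μ ((u : ℂ) + (ε : ℂ) * Complex.I)) (𝓝[>] 0) (𝓝 (green μ u)) := by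
  rw [tendsto_iff_norm_sub_tendsto_zero]
  have h0 : Tendsto (fun ε : ℝ => ε * (inverseSquareEnergy μ u).toReal) (𝓝[>] 0) (𝓝 0) := by
    have : ContinuousAt (fun ε : ℝ => ε * (inverseSquareEnergy μ u).toReal) 0 := by fun_prop
    simpa using this.tendsto.mono_left nhdsWithin_le_nhds
  refine squeeze_zero' (Eventually.of_forall fun _ => norm_nonneg _) ?_ h0
  filter_upwards [self_mem_nhdsWithin] with ε hε
  have hle := inverseSquareEnergy_add_mul_I_le μ u ε
  have hfin := ne_top_of_le_ne_top hu hle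
  have h1 := norm_resolventPairing_le hfin hu
  have h2 := ENNReal.toReal_mono hu hle
  rw [green_sub_green hfin hu, norm_neg, norm_mul, add_sub_cancel_left]
  simp only [norm_mul, Complex.norm_real, Real.norm_of_nonneg (le_of_lt (mem_Ioi.1 hε)),
    Complex.norm_I, mul_one]
  have := mem_Ioi.1 hε
  gcongr
  linarith

lemma deriv_charMap (s : ℝ) {z : ℂ} (hz : z.im ≠ 0) :
    deriv (charMap μ s) z = 1 - s * resolventPairing μ z z := by
  have h := (hasDerivAt_id z).add ((hasDerivAt_green (μ := μ) hz).const_mul (s : ℂ))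
  have h' : HasDerivAt (charMap μ s) (1 + s * -resolventPairing μ z z) z := h
  rw [h'.deriv]
  ring

lemma add_mul_I_im (u ε : ℝ) : ((u : ℂ) + (ε : ℂ) * Complex.I).im = ε := by simp

/-- If `G(u + i0)` is real and `-G'(u + i0)` is a real number `a`, then the vertical derivative of
`-Im G` at `u` is `a`; as `-Im G(u + iε) / ε` is the inverse square energy at `u + iε`, the energy
at `u` is at most `a` by Fatou's lemma. -/
lemma inverseSquareEnergy_le_of_tendsto {g a : ℝ}
    (hg : Tendsto (fun ε : ℝ => green μ ((u : ℂ) + (ε : ℂ) * Complex.I)) (𝓝[>] 0) (𝓝 (g : ℂ)))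
    (ha : Tendsto (fun ε : ℝ => resolventPairing μ ((u : ℂ) + (ε : ℂ) * Complex.I)
      ((u : ℂ) + (ε : ℂ) * Complex.I)) (𝓝[>] 0) (𝓝 (a : ℂ))) :
    inverseSquareEnergy μ u ≤ ENNReal.ofReal a := by
  let F : ℝ → ℝ := fun ε => -(green μ ((u : ℂ) + (ε : ℂ) * Complex.I)).im
  have hF0 : F 0 = 0 := by simp [F, green_ofReal_im]
  have hline : ∀ ε : ℝ, HasDerivAt (fun ε : ℝ => (u : ℂ) + (ε : ℂ) * Complex.I) Complex.I ε := by
    intro ε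
    simpa using (((hasDerivAt_id ε).ofReal_comp).mul_const Complex.I).const_add (u : ℂ)
  have hF : ∀ ε : ℝ, 0 < ε → HasDerivAt F (resolventPairing μ ((u : ℂ) + (ε : ℂ) * Complex.I)
      ((u : ℂ) + (ε : ℂ) * Complex.I)).re ε := by
    intro ε hε
    have h1 := (hasDerivAt_green (μ := μ) (z := (u : ℂ) + (ε : ℂ) * Complex.I)
      (by simpa using hε.ne')).scomp ε (hline ε)
    have h2 := (Complex.imCLM.hasFDerivAt.comp_hasDerivAt ε h1).neg
    refine (h2.congr_deriv ?_)
    simp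
  have hcont : ContinuousWithinAt F (Ioi 0) 0 := by
    have h := ((Complex.continuous_im.tendsto _).comp hg).neg
    rw [ContinuousWithinAt, hF0]
    simpa [F, Function.comp_def] using h
  have hderiv : Tendsto (fun ε => deriv F ε) (𝓝[>] 0) (𝓝 a) := by
    refine Tendsto.congr' ?_ ((Complex.continuous_re.tendsto _).comp ha)
    filter_upwards [self_mem_nhdsWithin] with ε hε
    exact (hF ε hε).deriv.symm
  have hslope := hasDerivWithinAt_Ici_of_tendsto_deriv
    (fun ε hε => (hF ε hε).differentiableAt.differentiableWithinAt) hcont self_mem_nhdsWithin hderiv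
  rw [← hasDerivWithinAt_Ioi_iff_Ici, hasDerivWithinAt_iff_tendsto_slope' (by simp)] at hslope
  have hE : Tendsto (fun ε : ℝ => inverseSquareEnergy μ ((u : ℂ) + (ε : ℂ) * Complex.I)) (𝓝[>] 0)
      (𝓝 (ENNReal.ofReal a)) := by
    refine (ENNReal.tendsto_ofReal hslope).congr' ?_
    filter_upwards [self_mem_nhdsWithin] with ε hε
    have hε' : ε ≠ 0 := (mem_Ioi.1 hε).ne'
    have hfin : inverseSquareEnergy μ ((u : ℂ) + (ε : ℂ) * Complex.I) ≠ ⊤ :=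
      inverseSquareEnergy_ne_top_of_im_ne_zero (by simpa using hε')
    rw [slope_def_field, hF0]
    simp only [F, green_im hfin, add_mul_I_im, neg_neg, sub_zero]
    rw [mul_div_cancel_left₀ _ hε', ENNReal.ofReal_toReal hfin]
  exact (inverseSquareEnergy_le_liminf (tendsto_add_mul_I u)).trans_eq hE.liminf_eq

/-- A real characteristic does not break down before time `t` exactly when the inverse square energy
at its starting point is at most `1 / t`. -/
lemma mem_charDomain_iff (ht : 0 < t) :
    u ∈ charDomain μ t ↔ inverseSquareEnergy μ u ≤ ENNReal.ofReal t⁻¹ := by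
  constructor
  · rintro ⟨⟨g, hg⟩, hm⟩
    have hpair : ∀ s ∈ Ioo 0 t, ∃ m : ℝ, 0 < m ∧
        Tendsto (fun ε : ℝ => resolventPairing μ ((u : ℂ) + (ε : ℂ) * Complex.I)
          ((u : ℂ) + (ε : ℂ) * Complex.I)) (𝓝[>] 0) (𝓝 (((1 - m) / s : ℝ) : ℂ)) := by
      intro s hs
      obtain ⟨m, hm0, hm⟩ := hm s ⟨hs.1.le, hs.2⟩
      refine ⟨m, hm0, ?_⟩
      have hs0 : (s : ℂ) ≠ 0 := by exact_mod_cast hs.1.ne'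
      have h := (hm.const_sub (1 : ℂ)).div_const (s : ℂ)
      push_cast
      refine h.congr' ?_
      filter_upwards [self_mem_nhdsWithin] with ε hε
      rw [deriv_charMap s (by simpa using (mem_Ioi.1 hε).ne')]
      field_simp
      ring
    -- The limit of the pairing does not depend on `s`, so it is below `1 / s` for every `s < t`.
    obtain ⟨m, -, hlim⟩ := hpair (t / 2) ⟨by linarith, by linarith⟩
    set a : ℝ := (1 - m) / (t / 2)
    refine (inverseSquareEnergy_le_of_tendsto hg hlim).trans (ENNReal.ofReal_le_ofReal ?_)
    by_contra! hlt
    have ha : 0 < a := lt_trans (by positivity) hlt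
    obtain ⟨m', hm', hlim'⟩ := hpair a⁻¹ ⟨by positivity, inv_lt_of_inv_lt₀ ht hlt⟩
    have := Complex.ofReal_injective (tendsto_nhds_unique hlim hlim')
    rw [div_inv_eq_mul] at this
    nlinarith
  · intro hu
    have hfin := ne_top_of_le_ofReal hu
    have hle := toReal_le_inv ht hu
    refine ⟨⟨(green μ u).re, by rw [ofReal_green_re]; exact tendsto_green_boundary hfin⟩,
      fun s hs => ⟨1 - s * (inverseSquareEnergy μ u).toReal, ?_, ?_⟩⟩
    · have h1 : s * (inverseSquareEnergy μ u).toReal ≤ s * t⁻¹ :=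
        mul_le_mul_of_nonneg_left hle hs.1
      have h2 : s * t⁻¹ < 1 := by rw [← div_eq_mul_inv, div_lt_one ht]; exact hs.2
      linarith
    · have h := ((tendsto_resolventPairing_boundary hfin).const_mul (s : ℂ)).const_sub 1
      push_cast
      refine h.congr' ?_
      filter_upwards [self_mem_nhdsWithin] with ε hε
      rw [deriv_charMap s (by simpa using (mem_Ioi.1 hε).ne')]

lemma realChar_eq (s : ℝ) (hu : inverseSquareEnergy μ u ≠ ⊤) :
    realChar μ s u = u + s * (green μ u).re := by
  have h := ((tendsto_green_boundary hu).const_mul (s : ℂ)).add_const (u : ℂ)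
  rw [realChar, h.limUnder_eq]
  simp [add_comm]

lemma realChar_sub (s : ℝ) (hu : inverseSquareEnergy μ u ≠ ⊤) (hv : inverseSquareEnergy μ v ≠ ⊤) :
    realChar μ s u - realChar μ s v = (u - v) * (1 - s * (resolventPairing μ u v).re) := by
  have h := congrArg Complex.re (green_sub_green hu hv)
  rw [← Complex.ofReal_sub] at h
  simp only [Complex.sub_re, Complex.neg_re, Complex.re_ofReal_mul] at h
  rw [realChar_eq s hu, realChar_eq s hv]
  linear_combination s * h

lemma injOn_realChar_charDomain {s : ℝ} (ht : 0 < t) (hs : s ∈ Icc 0 t) :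
    InjOn (realChar μ s) (charDomain μ t) := by
  intro u hu v hv huv
  rw [mem_charDomain_iff ht] at hu hv
  by_contra hne
  have hlt := resolventPairing_re_lt hne (ne_top_of_le_ofReal hu) (ne_top_of_le_ofReal hv)
  have h1 : (resolventPairing μ u v).re < t⁻¹ := by
    linarith [toReal_le_inv ht hu, toReal_le_inv ht hv]
  have h2 := realChar_sub s (ne_top_of_le_ofReal hu) (ne_top_of_le_ofReal hv)
  rw [huv, sub_self, zero_eq_mul, or_iff_right (sub_ne_zero.2 hne)] at h2
  have h3 : t * t⁻¹ = 1 := mul_inv_cancel₀ ht.ne'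
  rcases le_or_gt (resolventPairing μ u v).re 0 with h | h
  · nlinarith [mul_nonneg hs.1 (neg_nonneg.2 h)]
  · nlinarith [mul_le_mul_of_nonneg_right hs.2 h.le]

/-- Off the support, the energy criterion for the domain agrees with absence of local crossings:
characteristics issued from `u` and `v` meet at the time `s` where `s` times the pairing of `u` and
`v` is `1`, and the pairing tends to the energy at `x₀` as `u, v → x₀`. -/
lemma mem_charDomain_iff_noCrossingNear {x₀ : ℝ} (ht : 0 < t) (hx₀ : x₀ ∉ μ.support) :
    x₀ ∈ charDomain μ t ↔ NoCrossingNear μ t x₀ := by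
  obtain ⟨d, hd, hdist⟩ := exists_dist_of_notMem_support hx₀
  have hfin : ∀ u : ℝ, |u - x₀| < d → inverseSquareEnergy μ u ≠ ⊤ := fun u hu =>
    ne_top_of_le_ne_top ENNReal.ofReal_ne_top (inverseSquareEnergy_le_of_le_norm hd (hdist u hu))
  have hd0 : |x₀ - x₀| < d := by simpa using hd
  have hx₀fin := hfin x₀ hd0
  have hlim : ∀ c : ℝ, Tendsto (fun p : ℝ × ℝ => c * (resolventPairing μ p.1 p.2).re)
      (𝓝 x₀ ×ˢ 𝓝 x₀) (𝓝 (c * (inverseSquareEnergy μ x₀).toReal)) := by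
    intro c
    have h := tendsto_resolventPairing
      ((Complex.continuous_ofReal.tendsto x₀).comp (tendsto_fst (f := 𝓝 x₀) (g := 𝓝 x₀)))
      ((Complex.continuous_ofReal.tendsto x₀).comp (tendsto_snd (f := 𝓝 x₀) (g := 𝓝 x₀)))
      hd (hdist x₀ hd0) (hdist x₀ hd0)
    rw [resolventPairing_self_ofReal hx₀fin] at h
    simpa using ((Complex.continuous_re.tendsto _).comp h).const_mul c
  have hnear : ∀ᶠ u in 𝓝 x₀, |u - x₀| < d := by
    filter_upwards [Metric.ball_mem_nhds x₀ hd] with u hu using by simpa [Real.dist_eq] using hu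
  rw [mem_charDomain_iff ht]
  constructor
  · intro hle t' ht'
    have hlt : t' * (inverseSquareEnergy μ x₀).toReal < 1 := by
      have h1 := mul_le_mul_of_nonneg_left (toReal_le_inv ht hle) ht'.1
      have h2 : t' * t⁻¹ < 1 := by rw [← div_eq_mul_inv, div_lt_one ht]; exact ht'.2
      linarith
    obtain ⟨V, hV, hVlt⟩ := mem_prod_same_iff.1 ((hlim t').eventually_lt_const hlt)
    refine ⟨V ∩ {u | |u - x₀| < d}, inter_mem hV hnear, fun s hs u hu v hv huv => ?_⟩
    by_contra hne
    have h2 := realChar_sub s (hfin u hu.2) (hfin v hv.2)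
    rw [huv, sub_self, zero_eq_mul, or_iff_right (sub_ne_zero.2 hne)] at h2
    have h3 : t' * (resolventPairing μ u v).re < 1 := by
      have huv' : (u, v) ∈ V ×ˢ V := ⟨hu.1, hv.1⟩
      simpa only [mem_ofPred_eq] using hVlt huv'
    rcases le_or_gt (resolventPairing μ u v).re 0 with h | h
    · nlinarith [mul_nonneg hs.1 (neg_nonneg.2 h)]
    · nlinarith [mul_le_mul_of_nonneg_right hs.2 h.le]
  · intro hnc
    rw [← ENNReal.ofReal_toReal hx₀fin]
    refine ENNReal.ofReal_le_ofReal ?_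
    by_contra! hlt
    obtain ⟨t', h1, h2⟩ := exists_between (inv_lt_of_inv_lt₀ ht hlt)
    have hE : 0 < (inverseSquareEnergy μ x₀).toReal := lt_trans (by positivity) hlt
    have ht'0 : 0 < t' := lt_trans (by positivity) h1
    have h3 : 1 < t' * (inverseSquareEnergy μ x₀).toReal := by
      rw [inv_lt_iff_one_lt_mul₀ hE] at h1
      exact h1
    obtain ⟨U, hU, hinj⟩ := hnc t' ⟨ht'0.le, h2⟩
    have h4 : ∀ᶠ v : ℝ in 𝓝 x₀, 1 < t' * (resolventPairing μ x₀ v).re :=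
      ((tendsto_const_nhds (x := x₀)).prodMk tendsto_id).eventually
        ((hlim t').eventually_const_lt h3)
    have h5 : ∀ᶠ v : ℝ in 𝓝[≠] x₀, v ∈ U ∧ |v - x₀| < d ∧ 1 < t' * (resolventPairing μ x₀ v).re :=
      nhdsWithin_le_nhds (Filter.Eventually.and hU (hnear.and h4))
    obtain ⟨v, ⟨hvU, hvd, hv⟩, hvne⟩ := (h5.and self_mem_nhdsWithin).exists
    have hP : 0 < (resolventPairing μ x₀ v).re := by
      by_contra! h
      nlinarith
    refine hvne (hinj (resolventPairing μ x₀ v).re⁻¹ ⟨by positivity, ?_⟩ (mem_of_mem_nhds hU) hvU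
      (sub_eq_zero.1 ?_)).symm
    · rw [inv_le_iff_one_le_mul₀ hP]
      exact hv.le
    · rw [realChar_sub _ hx₀fin (hfin v hvd), inv_mul_cancel₀ hP.ne', sub_self, mul_zero]

end Boundary

/-! ### Transport of the Green's function along complex characteristics -/

section Transport

variable {μ : ℝ → ProbabilityMeasure ℝ}

/-- The test function `x ↦ (z - x)⁻²`, for nonreal `z`. -/
noncomputable def invSubSq (z : ℂ) (hz : z.im ≠ 0) : BoundedContinuousFunction ℝ ℂ :=
  BoundedContinuousFunction.ofNormedAddCommGroup (fun x : ℝ => (z - x)⁻¹ * (z - x)⁻¹)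
    (by
      have h : Continuous fun x : ℝ => (z - x)⁻¹ :=
        (by fun_prop : Continuous fun x : ℝ => z - x).inv₀ (sub_ofReal_ne_zero hz)
      exact h.mul h)
    (|z.im|⁻¹ * |z.im|⁻¹) (fun x => by
      have := abs_pos.2 hz
      rw [norm_mul, norm_inv]
      gcongr <;> exact abs_im_le_norm_sub z x)

lemma norm_inv_sub_le {z : ℂ} {d : ℝ} (hd : 0 < d) (hz : d ≤ z.im) (x : ℝ) :
    ‖(z - x)⁻¹‖ ≤ d⁻¹ := by
  rw [norm_inv]
  gcongr
  exact (hz.trans (le_abs_self _)).trans (abs_im_le_norm_sub z x)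

/-- The resolvent pairing is continuous in time jointly with one of its arguments. -/
lemma IsHydrodynamicFlow.tendsto_resolventPairing (hμ : IsHydrodynamicFlow μ) {S : Set ℝ} {s d : ℝ}
    (hS : S ⊆ Ici 0) (hs : s ∈ S) (hd : 0 < d) {Z : ℝ → ℂ} (hZ : ContinuousWithinAt Z S s)
    (hZd : ∀ r ∈ S, d ≤ (Z r).im) :
    Tendsto (fun r => resolventPairing (μ r : Measure ℝ) (Z r) (Z s)) (𝓝[S] s)
      (𝓝 (resolventPairing (μ s : Measure ℝ) (Z s) (Z s))) := by
  have him : ∀ r ∈ S, (Z r).im ≠ 0 := fun r hr => (hd.trans_le (hZd r hr)).ne'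
  have hweak : Tendsto (fun r => resolventPairing (μ r : Measure ℝ) (Z s) (Z s)) (𝓝[S] s)
      (𝓝 (resolventPairing (μ s : Measure ℝ) (Z s) (Z s))) :=
    (ProbabilityMeasure.tendsto_iff_forall_integral_rclike_tendsto ℂ).1
      ((hμ.continuousOn.mono hS) s hs) (invSubSq (Z s) (him s hs))
  have hdiff : Tendsto (fun r => resolventPairing (μ r : Measure ℝ) (Z r) (Z s) -
      resolventPairing (μ r : Measure ℝ) (Z s) (Z s)) (𝓝[S] s) (𝓝 0) := by
    have h0 : Tendsto (fun r => ‖Z r - Z s‖ * (d⁻¹ * d⁻¹ * d⁻¹)) (𝓝[S] s) (𝓝 0) := by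
      simpa using (tendsto_iff_norm_sub_tendsto_zero.1 hZ).mul_const (d⁻¹ * d⁻¹ * d⁻¹)
    refine squeeze_zero_norm' ?_ h0
    filter_upwards [self_mem_nhdsWithin] with r hr
    have e1 := inverseSquareEnergy_ne_top_of_im_ne_zero (μ := (μ r : Measure ℝ)) (him r hr)
    have e2 := inverseSquareEnergy_ne_top_of_im_ne_zero (μ := (μ r : Measure ℝ)) (him s hs)
    rw [resolventPairing, resolventPairing, ← integral_sub (integrable_inv_mul_inv e1 e2)
      (integrable_inv_mul_inv e2 e2)]
    refine (norm_integral_le_of_norm_le_const (C := ‖Z r - Z s‖ * (d⁻¹ * d⁻¹ * d⁻¹))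
      (ae_of_all _ fun x => ?_)).trans_eq (by simp)
    have n1 := sub_ofReal_ne_zero (him r hr) x
    have n2 := sub_ofReal_ne_zero (him s hs) x
    have hid : (Z r - x)⁻¹ * (Z s - x)⁻¹ - (Z s - x)⁻¹ * (Z s - x)⁻¹ =
        -((Z r - Z s) * ((Z r - x)⁻¹ * (Z s - x)⁻¹ * (Z s - x)⁻¹)) := by
      field_simp
      ring
    rw [hid, norm_neg, norm_mul, norm_mul, norm_mul]
    have b1 := norm_inv_sub_le hd (hZd r hr) x
    have b2 := norm_inv_sub_le hd (hZd s hs) x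
    gcongr
  simpa using hdiff.add hweak

/-- Along a straight line of velocity `g`, the Burgers equation says that `G` satisfies the linear
equation `h' = (h - g) P`, where `P` is the resolvent pairing. -/
lemma IsHydrodynamicFlow.hasDerivWithinAt_green_line (hμ : IsHydrodynamicFlow μ) {z g : ℂ}
    {τ s d : ℝ} (hs : s ∈ Icc 0 τ) (hd : 0 < d) (hline : ∀ r ∈ Icc 0 τ, d ≤ (z + (r : ℂ) * g).im) :
    HasDerivWithinAt (fun r : ℝ => green (μ r : Measure ℝ) (z + (r : ℂ) * g))
      ((green (μ s : Measure ℝ) (z + (s : ℂ) * g) - g) *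
        resolventPairing (μ s : Measure ℝ) (z + (s : ℂ) * g) (z + (s : ℂ) * g)) (Icc 0 τ) s := by
  have him : ∀ r ∈ Icc 0 τ, (z + (r : ℂ) * g).im ≠ 0 := fun r hr =>
    (hd.trans_le (hline r hr)).ne'
  have hcont : Continuous fun r : ℝ => z + (r : ℂ) * g := by fun_prop
  have htime := (hμ.burgers s hs.1 _ (him s hs)).mono (Icc_subset_Ici_self : Icc 0 τ ⊆ Ici 0)
  rw [(hasDerivAt_green (him s hs)).deriv] at htime
  have hpair := hμ.tendsto_resolventPairing Icc_subset_Ici_self hs hd hcont.continuousWithinAt hline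
  have hspace : HasDerivWithinAt (fun r : ℝ => green (μ r : Measure ℝ) (z + (r : ℂ) * g) -
      green (μ r : Measure ℝ) (z + (s : ℂ) * g))
      (-(g * resolventPairing (μ s : Measure ℝ) (z + (s : ℂ) * g) (z + (s : ℂ) * g)))
      (Icc 0 τ) s := by
    rw [hasDerivWithinAt_iff_tendsto_slope]
    refine ((hpair.mono_left (nhdsWithin_mono s sdiff_subset)).const_mul g).neg.congr' ?_
    filter_upwards [self_mem_nhdsWithin] with r hr
    have hne : (r : ℂ) - s ≠ 0 := by
      rw [← Complex.ofReal_sub]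
      exact_mod_cast sub_ne_zero.2 hr.2
    rw [slope_def_module, sub_self, sub_zero,
      green_sub_green (inverseSquareEnergy_ne_top_of_im_ne_zero (him r hr.1))
        (inverseSquareEnergy_ne_top_of_im_ne_zero (him s hs)), Complex.real_smul]
    push_cast
    field_simp
    ring
  refine ((hspace.add htime).congr_deriv (by ring)).congr_of_mem (fun r _ => ?_) hs
  simp

/-- Along a line staying in the upper half-plane, `G` is constantly equal to the velocity as soon as
it is so at one end: both are solutions of the same linear equation. -/
lemma IsHydrodynamicFlow.green_line_iff (hμ : IsHydrodynamicFlow μ) {z g : ℂ} {τ : ℝ} (hτ : 0 ≤ τ)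
    (h0 : 0 < z.im) (h1 : 0 < (z + (τ : ℂ) * g).im) :
    green (μ 0 : Measure ℝ) z = g ↔ green (μ τ : Measure ℝ) (z + (τ : ℂ) * g) = g := by
  obtain ⟨d, hd, hline⟩ : ∃ d > 0, ∀ r ∈ Icc 0 τ, d ≤ (z + (r : ℂ) * g).im := by
    refine ⟨min z.im (z + (τ : ℂ) * g).im, lt_min h0 h1, fun r hr => ?_⟩
    simp only [Complex.add_im, Complex.im_ofReal_mul]
    rcases le_total 0 g.im with h | h
    · exact (min_le_left _ _).trans (le_add_of_nonneg_right (mul_nonneg hr.1 h))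
    · exact (min_le_right _ _).trans
        (add_le_add_right (mul_le_mul_of_nonpos_right hr.2 h) _)
  let h : ℝ → ℂ := fun r => green (μ r : Measure ℝ) (z + (r : ℂ) * g)
  let P : ℝ → ℂ := fun r =>
    resolventPairing (μ r : Measure ℝ) (z + (r : ℂ) * g) (z + (r : ℂ) * g)
  have hderiv : ∀ r ∈ Icc 0 τ, HasDerivWithinAt h ((h r - g) * P r) (Icc 0 τ) r := fun r hr =>
    hμ.hasDerivWithinAt_green_line hr hd hline
  have hderiv' : ∀ (r : ℝ) (S : Set ℝ), HasDerivWithinAt (fun _ => g) ((g - g) * P r) S r := by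
    intro r S
    simpa using hasDerivWithinAt_const r S g
  have hcont : ContinuousOn h (Icc 0 τ) := fun r hr => (hderiv r hr).continuousWithinAt
  have hP : ∀ r ∈ Icc 0 τ, ‖P r‖ ≤ d⁻¹ * d⁻¹ := by
    intro r hr
    refine (norm_integral_le_of_norm_le_const (C := d⁻¹ * d⁻¹)
      (ae_of_all _ fun x => ?_)).trans_eq (by simp)
    rw [norm_mul]
    have := norm_inv_sub_le hd (hline r hr) x
    gcongr
  have hLip : ∀ r ∈ Icc 0 τ,
      LipschitzOnWith (Real.toNNReal (d⁻¹ * d⁻¹)) (fun w => (w - g) * P r) univ := by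
    intro r hr
    refine LipschitzOnWith.of_dist_le_mul fun a _ b _ => ?_
    rw [dist_eq_norm, dist_eq_norm, ← sub_mul, sub_sub_sub_cancel_right, norm_mul, mul_comm,
      Real.coe_toNNReal _ (by positivity)]
    gcongr
    exact hP r hr
  have hz : h 0 = green (μ 0 : Measure ℝ) z := by simp [h]
  rw [← hz]
  constructor
  · intro heq
    exact ODE_solution_unique_of_mem_Icc_right (v := fun r w => (w - g) * P r) (s := fun _ => univ)
      (fun r hr => hLip r (Ico_subset_Icc_self hr)) hcont
      (fun r hr => (hderiv r (Ico_subset_Icc_self hr)).mono_of_mem_nhdsWithin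
        (mem_of_superset (Icc_mem_nhdsGE hr.2) (Icc_subset_Icc_left hr.1)))
      (fun _ _ => mem_univ _) continuousOn_const (fun r _ => hderiv' r _) (fun _ _ => mem_univ _)
      heq (right_mem_Icc.2 hτ)
  · intro heq
    exact ODE_solution_unique_of_mem_Icc_left (v := fun r w => (w - g) * P r) (s := fun _ => univ)
      (fun r hr => hLip r (Ioc_subset_Icc_self hr)) hcont
      (fun r hr => (hderiv r (Ioc_subset_Icc_self hr)).mono_of_mem_nhdsWithin
        (mem_of_superset (Icc_mem_nhdsLE hr.1) (Icc_subset_Icc_right hr.2)))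
      (fun _ _ => mem_univ _) continuousOn_const (fun r _ => hderiv' r _) (fun _ _ => mem_univ _)
      heq (left_mem_Icc.2 hτ)

end Transport

/-! ### Boundary values of the Green's function and the density -/

section Density

open scoped ENNReal

variable {ν : ProbabilityMeasure ℝ} {f : ℝ → ℝ}

lemma IsContinuousDensity.inverseSquareEnergy_eq_lintegral (hf : IsContinuousDensity ν f) (z : ℂ) :
    inverseSquareEnergy (ν : Measure ℝ) z =
      ∫⁻ x : ℝ, ENNReal.ofReal (f x) * (‖z - x‖ₑ ^ 2)⁻¹ := by
  have := hf.continuous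
  rw [inverseSquareEnergy, hf.eq_withDensity,
    lintegral_withDensity_eq_lintegral_mul _ (by fun_prop) (by fun_prop)]
  rfl

lemma norm_sub_ofReal_sq (z : ℂ) (x : ℝ) : ‖z - x‖ ^ 2 = (z.re - x) ^ 2 + z.im ^ 2 := by
  rw [← Complex.normSq_eq_norm_sq, Complex.normSq_apply]
  simp
  ring

/-- A lower bound `c` for the density near `y` bounds `-Im G` below near `y`, in the whole upper
half-plane and not only along the vertical line: the part of the Poisson integral over the interval
of length `2 Im z` centred at `Re z` is already at least `c`. -/
lemma IsContinuousDensity.le_neg_green_im (hf : IsContinuousDensity ν f) {c δ y : ℝ} (hc : 0 ≤ c)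
    (hfc : ∀ x, |x - y| < δ → c ≤ f x) {z : ℂ} (hz : 0 < z.im) (hzδ : z.im + |z.re - y| < δ) :
    c ≤ -(green (ν : Measure ℝ) z).im := by
  have hfin := inverseSquareEnergy_ne_top_of_im_ne_zero (μ := (ν : Measure ℝ)) hz.ne'
  have h : ENNReal.ofReal (c / z.im) ≤ inverseSquareEnergy (ν : Measure ℝ) z := by
    rw [hf.inverseSquareEnergy_eq_lintegral]
    calc ENNReal.ofReal (c / z.im)
        = ∫⁻ _ in Icc (z.re - z.im) (z.re + z.im),
            ENNReal.ofReal (c * (2 * z.im ^ 2)⁻¹) := by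
          rw [setLIntegral_const, Real.volume_Icc, ← ENNReal.ofReal_mul (by positivity)]
          congr 1
          field_simp
          ring
      _ ≤ ∫⁻ x in Icc (z.re - z.im) (z.re + z.im), ENNReal.ofReal (f x) * (‖z - x‖ₑ ^ 2)⁻¹ := by
          refine setLIntegral_mono' measurableSet_Icc fun x hx => ?_
          have hx1 : |z.re - x| ≤ z.im := abs_le.2 ⟨by linarith [hx.2], by linarith [hx.1]⟩
          have hx2 : |x - y| < δ := by
            have := abs_sub_le x z.re y
            rw [abs_sub_comm x z.re] at this
            linarith
          have hpos : 0 < ‖z - x‖ := norm_pos_iff.2 (sub_ofReal_ne_zero hz.ne' x)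
          rw [inv_enorm_sq_eq (norm_pos_iff.1 hpos), ← ENNReal.ofReal_mul (hf.nonneg x), norm_inv,
            inv_pow]
          have hle : ‖z - x‖ ^ 2 ≤ 2 * z.im ^ 2 := by
            rw [norm_sub_ofReal_sq]
            nlinarith [sq_le_sq' (abs_le.1 hx1).1 (abs_le.1 hx1).2]
          have hfx := hfc x hx2
          gcongr
          exact hf.nonneg x
      _ ≤ _ := setLIntegral_le_lintegral _ _
  rw [green_im hfin, neg_neg]
  have h' := (ENNReal.ofReal_le_iff_le_toReal hfin).1 h
  rw [div_le_iff₀ hz] at h'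
  linarith

lemma lintegral_inv_enorm_sq (y : ℝ) {ε : ℝ} (hε : 0 < ε) :
    ∫⁻ x : ℝ, (‖(y : ℂ) + ε * Complex.I - x‖ₑ ^ 2)⁻¹ = ENNReal.ofReal (Real.pi / ε) := by
  obtain ⟨γ, rfl⟩ : ∃ γ : NNReal, (γ : ℝ) = ε := ⟨ε.toNNReal, Real.coe_toNNReal _ hε.le⟩
  have hγ : γ ≠ 0 := by exact_mod_cast hε.ne'
  rw [← mul_one (ENNReal.ofReal (Real.pi / γ)),
    ← ProbabilityTheory.lintegral_cauchyPDF_eq_one y hγ, ← lintegral_const_mul _ (by fun_prop)]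
  refine lintegral_congr fun x => ?_
  have him : ((y : ℂ) + ((γ : ℝ) : ℂ) * Complex.I).im ≠ 0 := by simpa using hε.ne'
  rw [inv_enorm_sq_eq (sub_ofReal_ne_zero him x), ProbabilityTheory.cauchyPDF_def,
    ProbabilityTheory.cauchyPDFReal_def, ← ENNReal.ofReal_mul (by positivity), norm_inv, inv_pow,
    norm_sub_ofReal_sq]
  have := Real.pi_pos
  congr 1
  simp only [Complex.add_re, Complex.ofReal_re, Complex.re_ofReal_mul, Complex.I_re,
    mul_zero, add_zero, add_mul_I_im]
  field_simp
  ring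

/-- An upper bound `c` for the density near `y` bounds the Poisson integral at `y + iε`. -/
lemma IsContinuousDensity.mul_inverseSquareEnergy_le (hf : IsContinuousDensity ν f) {c δ y ε : ℝ}
    (hc : 0 ≤ c) (hδ : 0 < δ) (hfc : ∀ x, |x - y| < δ → f x ≤ c) (hε : 0 < ε) :
    ε * (inverseSquareEnergy (ν : Measure ℝ) (y + ε * Complex.I)).toReal ≤
      c * Real.pi + ε * (δ ^ 2)⁻¹ := by
  have hπ := Real.pi_pos
  have h : inverseSquareEnergy (ν : Measure ℝ) (y + ε * Complex.I) ≤
      ENNReal.ofReal (c * (Real.pi / ε) + (δ ^ 2)⁻¹) := by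
    have hcont := hf.continuous
    have hmass : ∫⁻ x, ENNReal.ofReal (f x) = 1 := by
      have := measure_univ (μ := (ν : Measure ℝ))
      rwa [hf.eq_withDensity, withDensity_apply _ MeasurableSet.univ, setLIntegral_univ] at this
    calc inverseSquareEnergy (ν : Measure ℝ) (y + ε * Complex.I)
        = ∫⁻ x : ℝ, ENNReal.ofReal (f x) * (‖(y : ℂ) + ε * Complex.I - x‖ₑ ^ 2)⁻¹ :=
          hf.inverseSquareEnergy_eq_lintegral _
      _ ≤ ∫⁻ x : ℝ, (ENNReal.ofReal c * (‖(y : ℂ) + ε * Complex.I - x‖ₑ ^ 2)⁻¹ +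
            ENNReal.ofReal (f x) * ENNReal.ofReal ((δ ^ 2)⁻¹)) := by
          refine lintegral_mono fun x => ?_
          rcases lt_or_ge |x - y| δ with hx | hx
          · refine le_add_right ?_
            have := hfc x hx
            gcongr
          · refine le_add_left ?_
            have him : ((y : ℂ) + ε * Complex.I).im ≠ 0 := by simpa using hε.ne'
            rw [inv_enorm_sq_eq (sub_ofReal_ne_zero him x), norm_inv, inv_pow]
            gcongr
            refine le_trans ?_ (norm_sub_le_norm_add_mul_I_sub y ε x)
            rwa [← Complex.ofReal_sub, Complex.norm_real, Real.norm_eq_abs, abs_sub_comm]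
      _ = _ := by
          rw [lintegral_add_left (by fun_prop), lintegral_const_mul _ (by fun_prop),
            lintegral_inv_enorm_sq y hε, lintegral_mul_const _ (by fun_prop), hmass, one_mul,
            ← ENNReal.ofReal_mul hc, ← ENNReal.ofReal_add (by positivity) (by positivity)]
  have h' := mul_le_mul_of_nonneg_left (ENNReal.toReal_le_of_le_ofReal (by positivity) h) hε.le
  refine h'.trans_eq ?_
  field_simp

lemma IsContinuousDensity.tendsto_green_im_of_eq_zero (hf : IsContinuousDensity ν f) {y : ℝ}
    (hy : f y = 0) :
    Tendsto (fun ε : ℝ => (green (ν : Measure ℝ) ((y : ℂ) + (ε : ℂ) * Complex.I)).im)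
      (𝓝[>] 0) (𝓝 0) := by
  have hπ := Real.pi_pos
  rw [Metric.tendsto_nhds]
  intro η hη
  -- `c π` is half of the tolerance `η`.
  obtain ⟨δ, hδ, hδc⟩ := Metric.continuousAt_iff.1 (hf.continuous.continuousAt (x := y))
    (η / (2 * Real.pi)) (by positivity)
  have hfc : ∀ x, |x - y| < δ → f x ≤ η / (2 * Real.pi) := fun x hx => by
    have := hδc (x := x) (by rwa [Real.dist_eq])
    rw [hy, Real.dist_eq, sub_zero] at this
    exact (le_abs_self _).trans this.le
  have hsmall : ∀ᶠ ε : ℝ in 𝓝[>] 0, ε < η / 2 * δ ^ 2 :=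
    nhdsWithin_le_nhds (eventually_lt_nhds (by positivity))
  filter_upwards [hsmall, self_mem_nhdsWithin] with ε h1 hε
  have hε : 0 < ε := hε
  have h2 := hf.mul_inverseSquareEnergy_le (by positivity) hδ hfc hε
  have hfin := inverseSquareEnergy_ne_top_of_im_ne_zero (μ := (ν : Measure ℝ))
    (z := (y : ℂ) + (ε : ℂ) * Complex.I) (by simpa using hε.ne')
  rw [dist_zero_right, green_im hfin, add_mul_I_im, norm_neg, Real.norm_of_nonneg (by positivity)]
  refine h2.trans_lt ?_
  have h3 : η / (2 * Real.pi) * Real.pi = η / 2 := by field_simp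
  have h4 : ε * (δ ^ 2)⁻¹ < η / 2 := by
    rw [← div_eq_mul_inv, div_lt_iff₀ (by positivity)]
    exact h1
  linarith

end Density

/-! ### Zeros of the density and unbroken characteristics -/

section Zeros

variable {μ : ℝ → ProbabilityMeasure ℝ} {f : ℝ → ℝ} {t : ℝ}

lemma inverseSquareEnergy_add_mul_I_lt {μ : Measure ℝ} [IsProbabilityMeasure μ] {u ε : ℝ}
    (hu : inverseSquareEnergy μ u ≠ ⊤) (hε : 0 < ε) :
    inverseSquareEnergy μ (u + ε * Complex.I) < inverseSquareEnergy μ u := by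
  have him : ((u : ℂ) + ε * Complex.I).im ≠ 0 := by simpa using hε.ne'
  refine lintegral_strict_mono (IsProbabilityMeasure.ne_zero μ) (by fun_prop)
    (inverseSquareEnergy_ne_top_of_im_ne_zero him) ?_
  filter_upwards [ae_sub_ne_zero hu] with x hx
  rw [inv_enorm_sq_eq hx, inv_enorm_sq_eq (sub_ofReal_ne_zero him x)]
  have hpos := norm_pos_iff.2 hx
  refine (ENNReal.ofReal_lt_ofReal_iff (by rw [norm_inv]; positivity)).2 ?_
  rw [norm_inv, norm_inv, inv_pow, inv_pow]
  refine inv_strictAnti₀ (by positivity) ?_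
  rw [norm_sub_ofReal_sq, norm_sub_ofReal_sq]
  simp only [Complex.ofReal_re, Complex.ofReal_im, Complex.add_re, Complex.re_ofReal_mul,
    Complex.I_re, add_mul_I_im]
  nlinarith

/-- The image at time `t` of the vertical half-line above `u` lies in the upper half-plane and ends
at `M_t(u)`, and the values of `G(t, ·)` along it are those of `G(0, ·)` above `u`, whose imaginary
part tends to `0`. A positive density at `M_t(u)` would bound it away from `0`. -/
lemma IsHydrodynamicFlow.density_realChar_eq_zero (hμ : IsHydrodynamicFlow μ) (ht : 0 < t)
    (hf : IsContinuousDensity (μ t) f) {u : ℝ} (hu : u ∈ charDomain (μ 0 : Measure ℝ) t) :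
    f (realChar (μ 0 : Measure ℝ) t u) = 0 := by
  rw [mem_charDomain_iff ht] at hu
  have hfin := ne_top_of_le_ofReal hu
  set y := realChar (μ 0 : Measure ℝ) t u with hy
  by_contra hne
  have hpos : 0 < f y := lt_of_le_of_ne (hf.nonneg y) (Ne.symm hne)
  obtain ⟨δ, hδ, hδf⟩ := Metric.continuousAt_iff.1 (hf.continuous.continuousAt (x := y))
    (f y / 2) (by positivity)
  have hfc : ∀ x, |x - y| < δ → f y / 2 ≤ f x := fun x hx => by
    have := hδf (x := x) (by rwa [Real.dist_eq])
    rw [Real.dist_eq] at this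
    linarith [(abs_lt.1 this).1]
  let z : ℝ → ℂ := fun ε => (u : ℂ) + (ε : ℂ) * Complex.I
  let w : ℝ → ℂ := fun ε => z ε + (t : ℂ) * green (μ 0 : Measure ℝ) (z ε)
  have hG := tendsto_green_boundary (μ := (μ 0 : Measure ℝ)) hfin
  have hw : Tendsto w (𝓝[>] 0) (𝓝 (y : ℂ)) := by
    have h := (tendsto_add_mul_I u).add (hG.const_mul (t : ℂ))
    rw [← ofReal_green_re, ← Complex.ofReal_mul, ← Complex.ofReal_add, ← realChar_eq t hfin] at h
    exact h
  have hclose : Tendsto (fun ε => (w ε).im + |(w ε).re - y|) (𝓝[>] 0) (𝓝 0) := by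
    have h1 := (Complex.continuous_im.tendsto _).comp hw
    have h2 := (((Complex.continuous_re.tendsto _).comp hw).sub_const y).abs
    simpa using h1.add h2
  have him : Tendsto (fun ε => -(green (μ 0 : Measure ℝ) (z ε)).im) (𝓝[>] 0) (𝓝 0) := by
    have h := ((Complex.continuous_im.tendsto _).comp hG).neg
    rw [green_ofReal_im, neg_zero] at h
    exact h
  have hlt : ∀ᶠ ε : ℝ in 𝓝[>] 0, -(green (μ 0 : Measure ℝ) (z ε)).im < f y / 2 :=
    him.eventually_lt_const (by positivity)
  obtain ⟨ε, ⟨hε1, hε2⟩, hε⟩ :=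
    ((hlt.and (hclose.eventually_lt_const hδ)).and self_mem_nhdsWithin).exists
  have hε : 0 < ε := hε
  have hzim : (z ε).im = ε := add_mul_I_im u ε
  have hzfin := inverseSquareEnergy_ne_top_of_im_ne_zero (μ := (μ 0 : Measure ℝ)) (z := z ε)
    (by rw [hzim]; exact hε.ne')
  have hE : t * (inverseSquareEnergy (μ 0 : Measure ℝ) (z ε)).toReal < 1 := by
    have h1 := ENNReal.toReal_strict_mono hfin (inverseSquareEnergy_add_mul_I_lt hfin hε)
    have h2 := h1.trans_le (toReal_le_inv ht hu)
    rwa [inv_eq_one_div, lt_div_iff₀' ht] at h2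
  have hwim : 0 < (w ε).im := by
    simp only [w, Complex.add_im, Complex.im_ofReal_mul, green_im hzfin, hzim]
    nlinarith
  have htransport := (hμ.green_line_iff ht.le (by rw [hzim]; exact hε) hwim).1 rfl
  have := hf.le_neg_green_im (by positivity) hfc hwim hε2
  rw [show green (μ t : Measure ℝ) (w ε) = _ from htransport] at this
  linarith

/-- Following the complex characteristic that arrives at `w` at time `t` back to its starting point
`z` gives `z + t G(0, z) = w`, and since `z` stays in the upper half-plane up to time `t` the inverse
square energy at `z` is at most `1 / t`. -/
lemma IsHydrodynamicFlow.exists_start (hμ : IsHydrodynamicFlow μ) (ht : 0 < t) {w : ℂ}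
    (hw : 0 < w.im) : ∃ z : ℂ, z.im = w.im - t * (green (μ t : Measure ℝ) w).im ∧ 0 < z.im ∧
      z + t * green (μ 0 : Measure ℝ) z = w ∧
      inverseSquareEnergy (μ 0 : Measure ℝ) z ≤ ENNReal.ofReal t⁻¹ := by
  set g := green (μ t : Measure ℝ) w with hg
  have hgim : g.im ≤ 0 := by
    rw [hg, green_im (inverseSquareEnergy_ne_top_of_im_ne_zero hw.ne'), neg_nonpos]
    positivity
  have hzim : (w - t * g).im = w.im - t * g.im := by
    simp only [Complex.sub_im, Complex.im_ofReal_mul]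
  have hz : 0 < (w - t * g).im := by
    rw [hzim]
    nlinarith
  have hG : green (μ 0 : Measure ℝ) (w - t * g) = g :=
    (hμ.green_line_iff ht.le hz (by simpa using hw)).2 (by rw [sub_add_cancel])
  have hfin := inverseSquareEnergy_ne_top_of_im_ne_zero (μ := (μ 0 : Measure ℝ)) hz.ne'
  refine ⟨w - t * g, hzim, hz, by rw [hG, sub_add_cancel], ?_⟩
  rw [← ENNReal.ofReal_toReal hfin]
  refine ENNReal.ofReal_le_ofReal ?_
  have h1 := green_im hfin
  rw [hG] at h1
  -- `Im w = Im z (1 - t E)` with `Im w` and `Im z` positive, `E` being the energy at `z`.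
  have h2 : w.im = (w - t * g).im * (1 - t * (inverseSquareEnergy (μ 0 : Measure ℝ)
      (w - t * g)).toReal) := by
    linear_combination -hzim + t * h1
  have h3 := pos_of_mul_pos_right (h2 ▸ hw) hz.le
  rw [inv_eq_one_div, le_div_iff₀' ht]
  linarith

/-- At a zero `y` of the density, the starting points of the complex characteristics arriving at
`y + iε` are bounded and approach the real line. By Fatou's lemma a cluster point `u` lies in the
domain, and `G(0, ·)` is Lipschitz with constant `1 / t` where the energy is at most `1 / t`, which
allows passing to the limit in `z + t G(0, z) = y + iε`. -/
lemma IsHydrodynamicFlow.mem_charImage_of_density_eq_zero (hμ : IsHydrodynamicFlow μ) (ht : 0 < t)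
    (hf : IsContinuousDensity (μ t) f) {y : ℝ} (hy : f y = 0) :
    y ∈ charImage (μ 0 : Measure ℝ) t := by
  have hε0 : ∀ n : ℕ, 0 < 1 / ((n : ℝ) + 1) := fun n => by positivity
  have hε : Tendsto (fun n : ℕ => 1 / ((n : ℝ) + 1)) atTop (𝓝[>] 0) :=
    tendsto_nhdsWithin_iff.2 ⟨tendsto_one_div_add_atTop_nhds_zero_nat, Eventually.of_forall hε0⟩
  let w : ℕ → ℂ := fun n => (y : ℂ) + ((1 / ((n : ℝ) + 1) : ℝ) : ℂ) * Complex.I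
  have hwim : ∀ n, (w n).im = 1 / ((n : ℝ) + 1) := fun n => add_mul_I_im _ _
  have hwlim : Tendsto w atTop (𝓝 (y : ℂ)) := (tendsto_add_mul_I y).comp hε
  choose z hzim hzpos hzw hzE using fun n =>
    hμ.exists_start ht (w := w n) (by rw [hwim]; exact hε0 n)
  have hzfin : ∀ n, inverseSquareEnergy (μ 0 : Measure ℝ) (z n) ≠ ⊤ := fun n =>
    ne_top_of_le_ne_top ENNReal.ofReal_ne_top (hzE n)
  have hzlim : Tendsto (fun n => (z n).im) atTop (𝓝 0) := by
    have h1 := (Complex.continuous_im.tendsto _).comp hwlim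
    have h2 := ((hf.tendsto_green_im_of_eq_zero hy).comp hε).const_mul t
    have h3 := h1.sub h2
    simp only [Complex.ofReal_im, mul_zero, sub_zero] at h3
    exact h3.congr fun n => (hzim n).symm
  have hzbdd : ∀ n, z n ∈ Metric.closedBall (y : ℂ) (1 + t * ((1 + t⁻¹) / 2)) := by
    intro n
    rw [mem_closedBall_iff_norm]
    have h1 : z n - y = ((1 / ((n : ℝ) + 1) : ℝ) : ℂ) * Complex.I -
        t * green (μ 0 : Measure ℝ) (z n) := by
      linear_combination hzw n
    have h2 : 1 / ((n : ℝ) + 1) ≤ 1 := by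
      rw [div_le_one (by positivity)]
      linarith [Nat.cast_nonneg (α := ℝ) n]
    have h3 : ‖green (μ 0 : Measure ℝ) (z n)‖ ≤ (1 + t⁻¹) / 2 :=
      (norm_green_le (hzfin n)).trans (by linarith [toReal_le_inv ht (hzE n)])
    rw [h1]
    refine (norm_sub_le _ _).trans ?_
    rw [norm_mul, norm_mul, Complex.norm_I, mul_one, Complex.norm_real, Complex.norm_real,
      Real.norm_of_nonneg (hε0 n).le, Real.norm_of_nonneg ht.le]
    gcongr
  obtain ⟨a, -, φ, hφ, ha⟩ := (isCompact_closedBall _ _).tendsto_subseq hzbdd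
  have haim : a.im = 0 := tendsto_nhds_unique ((Complex.continuous_im.tendsto _).comp ha)
    (hzlim.comp hφ.tendsto_atTop)
  obtain ⟨u, rfl⟩ : ∃ u : ℝ, (u : ℂ) = a := ⟨a.re, Complex.ext (by simp) (by simp [haim])⟩
  have huE : inverseSquareEnergy (μ 0 : Measure ℝ) u ≤ ENNReal.ofReal t⁻¹ := by
    refine (inverseSquareEnergy_le_liminf ha).trans ?_
    refine (liminf_le_liminf (Eventually.of_forall fun n => hzE (φ n))).trans_eq ?_
    exact liminf_const _
  have hufin := ne_top_of_le_ofReal huE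
  have hGlim : Tendsto (fun n => green (μ 0 : Measure ℝ) (z (φ n))) atTop
      (𝓝 (green (μ 0 : Measure ℝ) u)) := by
    rw [tendsto_iff_norm_sub_tendsto_zero]
    have h0 : Tendsto (fun n => ‖z (φ n) - u‖ * t⁻¹) atTop (𝓝 0) := by
      simpa using (tendsto_iff_norm_sub_tendsto_zero.1 ha).mul_const t⁻¹
    refine squeeze_zero (fun _ => norm_nonneg _) (fun n => ?_) h0
    rw [green_sub_green (hzfin _) hufin, norm_neg, norm_mul]
    have h1 := norm_resolventPairing_le (hzfin (φ n)) hufin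
    have h2 := toReal_le_inv ht (hzE (φ n))
    have h3 := toReal_le_inv ht huE
    gcongr
    linarith
  refine ⟨u, (mem_charDomain_iff ht).2 huE, ?_⟩
  have h1 : Tendsto (w ∘ φ) atTop (𝓝 (u + t * green (μ 0 : Measure ℝ) u)) :=
    (ha.add (hGlim.const_mul (t : ℂ))).congr fun n => hzw (φ n)
  have h2 := tendsto_nhds_unique (hwlim.comp hφ.tendsto_atTop) h1
  rw [← ofReal_green_re, ← Complex.ofReal_mul, ← Complex.ofReal_add] at h2
  rw [realChar_eq t hufin]
  exact (Complex.ofReal_injective h2).symm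

end Zeros

theorem proposition6 (μ : ℝ → ProbabilityMeasure ℝ) (hμ : IsHydrodynamicFlow μ)
    (ρ : ℝ → ℝ → ℝ) (hρ : ∀ t : ℝ, 0 < t → IsContinuousDensity (μ t) (ρ t))
    (t : ℝ) (ht : 0 < t) :
    (∀ s ∈ Icc (0 : ℝ) t, InjOn (realChar (μ 0 : Measure ℝ) s) (charDomain (μ 0 : Measure ℝ) t)) ∧
    (∀ x₀ : ℝ, x₀ ∉ (μ 0 : Measure ℝ).support →
      (x₀ ∈ charDomain (μ 0 : Measure ℝ) t ↔ NoCrossingNear (μ 0 : Measure ℝ) t x₀)) ∧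
    Function.support (ρ t) = (charImage (μ 0 : Measure ℝ) t)ᶜ := by
  refine ⟨fun s hs => injOn_realChar_charDomain ht hs,
    fun x₀ hx₀ => mem_charDomain_iff_noCrossingNear ht hx₀, ?_⟩
  ext y
  rw [Function.mem_support, mem_compl_iff, not_iff_not]
  refine ⟨fun hy => hμ.mem_charImage_of_density_eq_zero ht (hρ t ht) hy, ?_⟩
  rintro ⟨u, hu, rfl⟩
  exact hμ.density_realChar_eq_zero ht (hρ t ht) hu
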